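/- For a finite group $G$ let $\rho(G)=\prod_{x\in G} o(x)$, where $o(x)$ is the order of $x$, let $\Omega(n)$ be the number of prime factors of the positive integer $n$ counted with multiplicity, and put $\Omega_\rho(G)=\Omega(\rho(G))$. Let $L_2(13)=\mathrm{PSL}_2(\mathbb{F}_{13})=\mathrm{SL}_2(\mathbb{F}_{13})/Z(\mathrm{SL}_2(\mathbb{F}_{13}))$. Then for every group $G$ of order $1092$, $$\Omega_\rho(G)\ \ge\ \Omega_\rho(L_2(13)) = 1273,$$ and $\Omega_\rho(G)=1273$ if and only if $G\cong L_2(13)$. -/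

import Mathlib

noncomputable section

/-- The product `ρ(G)` of the orders of all elements of a finite group `G`. -/
def rhoOrd (G : Type*) [Group G] [Finite G] : ℕ := ∏ᶠ x : G, orderOf x

/-- `Ω_ρ(G) = Ω(ρ(G))`, the number of prime factors of `ρ(G)` counted with multiplicity. -/
def OmegaRho (G : Type*) [Group G] [Finite G] : ℕ := ArithmeticFunction.cardFactors (rhoOrd G)

/-- `L₂(13) = PSL(2, 13)`, the quotient of `SL(2, 13)` by its centre. -/
abbrev L213 : Type := Matrix.ProjectiveSpecialLinearGroup (Fin 2) (ZMod 13)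

end

/-! A nontrivial element contributes at least 1 to `OmegaRho G`, and at least 2 if its order is not
prime, so `OmegaRho G` is at least 1091 plus the number of composite elements. In `L213` these all
have order 6, and there are 182 of them, which gives 1273. It remains to show that a group of order
1092 with at most 182 composite elements is isomorphic to `L213`.

A normal Sylow 13- or 7-subgroup would force too many composite elements, either in its centralizer
or above the generators of the cyclic quotient by the centralizer. Hence there are 14 Sylow
13-subgroups and 78 Sylow 7-subgroups. A nontrivial element acting trivially on the 14 points would
commute with all 468 elements of order 7, giving 468 composite products, so the action is faithful
(`toPermHom_sylow_thirteen_injective`).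

Labelling the points by the projective line over `ZMod 13` turns a Sylow 13-subgroup into the
translations and its normalizer into affine maps. By `coe_eq_squareMoebius` the image is then one
fixed set of permutations. Since `L213` satisfies the same hypotheses, both groups are isomorphic to
the same permutation group; no explicit action of matrices on the line is needed. -/

/-! ### Prime factors of element orders and composite elements -/

/-- The elements of a group that are neither trivial nor of prime order. -/
def compositeElements (G : Type*) [Group G] : Set G := {x | x ≠ 1 ∧ ¬ (orderOf x).Prime}

theorem OmegaRho_eq_finsum (G : Type*) [Group G] [Fintype G] :
    OmegaRho G = ∑ x : G, ArithmeticFunction.cardFactors (orderOf x) := by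
  unfold OmegaRho rhoOrd
  rw [finprod_eq_prod_of_fintype]
  have key : ∀ s : Finset G, ArithmeticFunction.cardFactors (∏ x ∈ s, orderOf x) =
      ∑ x ∈ s, ArithmeticFunction.cardFactors (orderOf x) := by
    classical
    intro s
    induction s using Finset.induction_on with
    | empty => simp
    | insert a s ha ih =>
      rw [Finset.prod_insert ha, Finset.sum_insert ha, ArithmeticFunction.cardFactors_mul, ih]
      · exact (orderOf_pos a).ne'
      · exact Finset.prod_ne_zero_iff.2 fun x _ => (orderOf_pos x).ne'
  exact key _

theorem OmegaRho_congr {G H : Type*} [Group G] [Finite G] [Group H] [Finite H] (e : G ≃* H) :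
    OmegaRho G = OmegaRho H := by
  have := Fintype.ofFinite G
  have := Fintype.ofFinite H
  rw [OmegaRho_eq_finsum, OmegaRho_eq_finsum]
  exact Fintype.sum_equiv e.toEquiv _ _ fun x => by
    rw [← MulEquiv.orderOf_eq e x]; rfl

open Classical in
theorem sum_indicator_ne_one_add_composite (G : Type*) [Group G] [Fintype G] :
    ∑ x : G, ((if x ≠ 1 then 1 else 0) + if x ∈ compositeElements G then 1 else 0) =
      (Nat.card G - 1) + (compositeElements G).ncard := by
  rw [Finset.sum_add_distrib, ← Finset.card_filter, ← Finset.card_filter]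
  congr 1
  · rw [Finset.filter_ne', Finset.card_erase_of_mem (Finset.mem_univ _), Finset.card_univ,
      Nat.card_eq_fintype_card]
  · rw [Set.ncard_eq_toFinset_card', Set.toFinset_card, Fintype.card_subtype]

theorem two_le_cardFactors {n : ℕ} (h0 : n ≠ 0) (h1 : n ≠ 1) (hp : ¬ n.Prime) :
    2 ≤ ArithmeticFunction.cardFactors n := by
  by_contra! h
  interval_cases hn : ArithmeticFunction.cardFactors n
  · rw [ArithmeticFunction.cardFactors_eq_zero_iff_eq_zero_or_one] at hn
    tauto
  · exact hp (ArithmeticFunction.cardFactors_eq_one_iff_prime.1 hn)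

/-- Each nontrivial element counts once, and each composite one at least once more. -/
theorem card_add_ncard_compositeElements_le (G : Type*) [Group G] [Finite G] :
    (Nat.card G - 1) + (compositeElements G).ncard ≤ OmegaRho G := by
  classical
  have := Fintype.ofFinite G
  rw [OmegaRho_eq_finsum, ← sum_indicator_ne_one_add_composite]
  refine Finset.sum_le_sum fun x _ => ?_
  by_cases h1 : x = 1
  · simp [h1, compositeElements]
  by_cases hp : (orderOf x).Prime
  · simp [h1, hp, compositeElements, ArithmeticFunction.cardFactors_apply_prime hp]
  · have := two_le_cardFactors (orderOf_pos x).ne' (by rwa [Ne, orderOf_eq_one_iff]) hp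
    simpa [h1, hp, compositeElements] using this

theorem OmegaRho_eq_of_compositeElements (G : Type*) [Group G] [Finite G]
    (h : ∀ x ∈ compositeElements G, ArithmeticFunction.cardFactors (orderOf x) = 2) :
    OmegaRho G = (Nat.card G - 1) + (compositeElements G).ncard := by
  classical
  have := Fintype.ofFinite G
  rw [OmegaRho_eq_finsum, ← sum_indicator_ne_one_add_composite]
  refine Finset.sum_congr rfl fun x _ => ?_
  by_cases h1 : x = 1
  · simp [h1, compositeElements]
  by_cases hp : (orderOf x).Prime
  · simp [h1, hp, compositeElements, ArithmeticFunction.cardFactors_apply_prime hp]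
  · have hx : x ∈ compositeElements G := ⟨h1, hp⟩
    simp [h1, hx, h x hx]

/-! ### Composite elements forced by a normal subgroup of prime order -/

theorem mem_compositeElements_of_map {G Q : Type*} [Group G] [Group Q] (f : G →* Q) {x : G}
    (h : f x ∈ compositeElements Q) : x ∈ compositeElements G := by
  refine ⟨fun hx => h.1 (by rw [hx, map_one]), fun hp => ?_⟩
  rcases (Nat.dvd_prime hp).1 (orderOf_map_dvd f x) with h1 | h1
  · exact h.1 (orderOf_eq_one_iff.1 h1)
  · exact h.2 (h1 ▸ hp)

/-- The order of an image divides the order of the element, so whole fibres over composite elements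
are composite, and each fibre is a coset of the kernel. -/
theorem card_ker_mul_ncard_compositeElements_range_le {G Q : Type*} [Group G] [Finite G] [Group Q]
    (f : G →* Q) :
    Nat.card f.ker * (compositeElements f.range).ncard ≤ (compositeElements G).ncard := by
  have e := QuotientGroup.quotientKerEquivRange f
  have h1 : (compositeElements f.range).ncard = (compositeElements (G ⧸ f.ker)).ncard := by
    rw [← Set.ncard_image_of_injective (compositeElements (G ⧸ f.ker)) e.injective]
    congr 1
    ext y
    obtain ⟨x, rfl⟩ := e.surjective y
    simp [compositeElements, MulEquiv.orderOf_eq]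
  rw [h1, ← Nat.card_coe_set_eq, ← QuotientGroup.card_preimage_mk, Nat.card_coe_set_eq]
  exact Set.ncard_le_ncard
    (fun x hx => mem_compositeElements_of_map (QuotientGroup.mk' f.ker) hx) (Set.toFinite _)

theorem totient_le_ncard_compositeElements (Q : Type*) [Group Q] [Finite Q] [IsCyclic Q]
    (h1 : Nat.card Q ≠ 1) (hp : ¬ (Nat.card Q).Prime) :
    (Nat.card Q).totient ≤ (compositeElements Q).ncard := by
  classical
  have := Fintype.ofFinite Q
  rw [Nat.card_eq_fintype_card] at *
  rw [← IsCyclic.card_orderOf_eq_totient (α := Q) dvd_rfl, ← Set.ncard_coe_finset]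
  refine Set.ncard_le_ncard (fun x hx => ?_) (Set.toFinite _)
  have hx : orderOf x = Fintype.card Q := by simpa using hx
  exact ⟨fun h => h1 (by rw [← hx, h, orderOf_one]), hx ▸ hp⟩

/-- If every element of prime order `p` lies in the subgroup `P` of order `p`, then the
centralizer of `P` contains many elements that are not of prime order. -/
theorem sub_one_mul_card_le_mul_ncard_compositeElements {G : Type*} [Group G] [Finite G] {p : ℕ}
    (hp : p.Prime) (P C : Subgroup G) (hP : Nat.card P = p)
    (hcomm : ∀ x ∈ C, ∀ u ∈ P, Commute x u) (hmem : ∀ x : G, orderOf x = p → x ∈ P) :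
    (p - 1) * (Nat.card C - p) ≤ p * (compositeElements G).ncard := by
  have hu : ∀ u ∈ P, u ≠ 1 → orderOf u = p := fun u huP hu1 => by
    have := (Subgroup.orderOf_dvd_natCard P huP)
    rw [hP] at this
    rcases (Nat.dvd_prime hp).1 this with h | h
    · exact absurd (orderOf_eq_one_iff.1 h) hu1
    · exact h
  have hcomp : ∀ x ∈ C, x ∉ P → x ∉ compositeElements G → ∀ u ∈ P, u ≠ 1 →
      x * u ∈ compositeElements G := by
    intro x hxC hxP hx u huP hu1
    have hx1 : x ≠ 1 := fun h => hxP (h ▸ P.one_mem)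
    have hxp : (orderOf x).Prime := by
      by_contra h
      exact hx ⟨hx1, h⟩
    have hne : orderOf x ≠ p := fun h => hxP (hmem x h)
    have ho : orderOf (x * u) = orderOf x * p := by
      rw [(hcomm x hxC u huP).orderOf_mul_eq_mul_orderOf_of_coprime, hu u huP hu1]
      rw [hu u huP hu1]
      exact (Nat.coprime_primes hxp hp).2 hne
    refine ⟨fun h => ?_, ?_⟩
    · rw [h, orderOf_one] at ho
      exact hp.one_lt.ne' (Nat.eq_one_of_mul_eq_one_left ho.symm)
    · rw [ho]
      exact Nat.not_prime_mul hxp.one_lt.ne' hp.one_lt.ne'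
  set S : Set G := {x | x ∈ C ∧ x ∉ P ∧ x ∉ compositeElements G} with hS
  set U : Set G := {u | u ∈ P ∧ u ≠ 1} with hU
  have hUcard : U.ncard = p - 1 := by
    have : U = (P : Set G) \ {1} := by ext; simp [hU]
    rw [this, Set.ncard_sdiff_singleton_of_mem P.one_mem, ← Nat.card_coe_set_eq]
    exact congrArg (· - 1) hP
  -- Each prime-order `x` in `C` outside `P` yields `p - 1` composite products. They are distinct: a
  -- coset of `P` contains at most one such `x`, as its other translates are composite.
  have h1 : S.ncard * (p - 1) ≤ (compositeElements G).ncard := by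
    rw [← hUcard, ← Set.ncard_prod]
    refine Set.ncard_le_ncard_of_injOn (fun y => y.1 * y.2) ?_ ?_ (Set.toFinite _)
    · rintro ⟨x, u⟩ ⟨hx, hu⟩
      exact hcomp x hx.1 hx.2.1 hx.2.2 u hu.1 hu.2
    · rintro ⟨x, u⟩ ⟨hx, hu⟩ ⟨y, v⟩ ⟨hy, hv⟩ h
      simp only at h hx hu hy hv
      have hxy : x * (u * v⁻¹) = y := by rw [← mul_assoc, h]; group
      by_cases huv : u * v⁻¹ = 1
      · rw [huv, mul_one] at hxy
        rw [hxy, mul_inv_eq_one.1 huv]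
      · exact absurd (hxy ▸ hcomp x hx.1 hx.2.1 hx.2.2 _
          (P.mul_mem hu.1 (P.inv_mem hv.1)) huv) hy.2.2
  have h2 : Nat.card C ≤ p + S.ncard + (compositeElements G).ncard := by
    have hsub : (C : Set G) ⊆ ((P : Set G) ∪ S) ∪ compositeElements G := by
      intro x hx
      by_cases hxP : x ∈ P
      · exact Or.inl (Or.inl hxP)
      by_cases hxc : x ∈ compositeElements G
      · exact Or.inr hxc
      · exact Or.inl (Or.inr ⟨hx, hxP, hxc⟩)
    have h3 := (Set.ncard_le_ncard hsub (Set.toFinite _)).trans (Set.ncard_union_le _ _)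
    have h4 := Set.ncard_union_le (P : Set G) S
    have h5 : (P : Set G).ncard = p := hP
    have h6 : (C : Set G).ncard = Nat.card C := rfl
    omega
  obtain ⟨q, rfl⟩ : ∃ q, p = q + 1 := ⟨p - 1, by have := hp.one_lt; omega⟩
  simp only [Nat.add_sub_cancel] at h1 ⊢
  calc q * (Nat.card C - (q + 1)) ≤ q * (S.ncard + (compositeElements G).ncard) :=
        Nat.mul_le_mul_left _ (by omega)
    _ ≤ (q + 1) * (compositeElements G).ncard := by nlinarith

/-- Here `c` is the order of the centralizer of `P` and `m` that of the image of `G` in the cyclic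
group `MulAut P` of order `p - 1`. If `m` is neither 1 nor prime, everything above the `m.totient`
generators of the image is composite. -/
theorem exists_card_mul_card_eq_of_normal {G : Type*} [Group G] [Finite G] {p : ℕ}
    (hp : p.Prime) (P : Subgroup G) [P.Normal] (hP : Nat.card P = p)
    (hmem : ∀ x : G, orderOf x = p → x ∈ P) :
    ∃ c m : ℕ, c * m = Nat.card G ∧ m ∣ p - 1 ∧
      (p - 1) * (c - p) ≤ p * (compositeElements G).ncard ∧
      (m ≠ 1 → ¬ m.Prime → c * m.totient ≤ (compositeElements G).ncard) := by
  have : Fact p.Prime := ⟨hp⟩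
  have hcyc : IsCyclic P := isCyclic_of_prime_card hP
  let f : G →* MulAut P := MulAut.conjNormal
  have e := IsCyclic.mulAutMulEquiv P
  have hcard : Nat.card (MulAut P) = p - 1 := by
    rw [Nat.card_congr e.toEquiv, hP, Nat.card_eq_fintype_card, ZMod.card_units]
  have hfin : Finite (MulAut P) := Nat.finite_of_card_ne_zero (by have := hp.one_lt; omega)
  have hcyc2 : IsCyclic (MulAut P) := by
    rw [hP] at e
    exact isCyclic_of_surjective e.symm e.symm.surjective
  refine ⟨Nat.card f.ker, Nat.card f.range, ?_, ?_, ?_, ?_⟩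
  · rw [← Subgroup.index_ker, Subgroup.card_mul_index]
  · exact hcard ▸ Subgroup.card_subgroup_dvd_card f.range
  · have hcomm : ∀ x ∈ f.ker, ∀ u ∈ P, Commute x u := by
      intro x hx u hu
      have h1 : f x ⟨u, hu⟩ = ⟨u, hu⟩ := by rw [MonoidHom.mem_ker.1 hx]; rfl
      have h2 : x * u * x⁻¹ = u := by
        simpa [f, MulAut.conjNormal_apply] using congrArg Subtype.val h1
      exact mul_inv_eq_iff_eq_mul.1 h2
    exact sub_one_mul_card_le_mul_ncard_compositeElements hp P f.ker hP hcomm hmem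
  · intro h1 h2
    exact (Nat.mul_le_mul_left _ (totient_le_ncard_compositeElements f.range h1 h2)).trans
      (card_ker_mul_ncard_compositeElements_range_le f)

/-! ### Sylow subgroups of prime order -/

theorem Sylow.card_eq_of_card_eq_mul {G : Type*} [Group G] [Finite G] {p k : ℕ} [hp : Fact p.Prime]
    (hG : Nat.card G = p * k) (hk : ¬ p ∣ k) (P : Sylow p G) : Nat.card P = p := by
  have hk0 : k ≠ 0 := fun h => hk (h ▸ dvd_zero p)
  rw [Sylow.card_eq_multiplicity, hG, Nat.factorization_mul hp.out.ne_zero hk0]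
  simp [hp.out.factorization_self, Nat.factorization_eq_zero_of_not_dvd hk]

theorem exists_mem_sylow_of_orderOf_eq {G : Type*} [Group G] {p : ℕ} {x : G}
    (hx : orderOf x = p) : ∃ P : Sylow p G, x ∈ P := by
  have h : IsPGroup p (Subgroup.zpowers x) := IsPGroup.of_card (n := 1) (by
    rw [Nat.card_zpowers, hx, pow_one])
  obtain ⟨P, hP⟩ := h.exists_le_sylow
  exact ⟨P, hP (Subgroup.mem_zpowers x)⟩

theorem Subgroup.eq_zpowers_of_prime_card {G : Type*} [Group G] {p : ℕ} (hp : p.Prime)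
    {P : Subgroup G} (hP : Nat.card P = p) {x : G} (hx : x ∈ P) (h1 : x ≠ 1) :
    P = Subgroup.zpowers x := by
  have : Finite P := Nat.finite_of_card_ne_zero (hP ▸ hp.ne_zero)
  have hdvd := Subgroup.orderOf_dvd_natCard P hx
  rw [hP] at hdvd
  have ho : orderOf x = p := ((Nat.dvd_prime hp).1 hdvd).resolve_left
    fun h => h1 (orderOf_eq_one_iff.1 h)
  refine (Subgroup.eq_of_le_of_card_ge ((Subgroup.zpowers_le).2 hx) ?_).symm
  rw [Nat.card_zpowers, ho, hP]

/-- Distinct subgroups of order `p` meet trivially, so their nontrivial elements are disjoint sets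
of size `p - 1`. -/
theorem card_sylow_mul_le_ncard_orderOf_eq {G : Type*} [Group G] [Finite G] {p : ℕ}
    [hp : Fact p.Prime] (hP : ∀ P : Sylow p G, Nat.card P = p) :
    Nat.card (Sylow p G) * (p - 1) ≤ {x : G | orderOf x = p}.ncard := by
  have := Fintype.ofFinite (Sylow p G)
  have hcard : Nat.card (Σ P : Sylow p G, {x : G // x ∈ P ∧ x ≠ 1}) =
      Nat.card (Sylow p G) * (p - 1) := by
    rw [Nat.card_sigma, Finset.sum_const_nat (m := p - 1), Finset.card_univ,
      Nat.card_eq_fintype_card]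
    intro P _
    have h1 : {x : G | x ∈ P ∧ x ≠ 1} = ((P : Subgroup G) : Set G) \ {1} := by ext; simp
    have h2 : {x : G | x ∈ P ∧ x ≠ 1}.ncard = p - 1 := by
      rw [h1, Set.ncard_sdiff_singleton_of_mem (P : Subgroup G).one_mem, ← Nat.card_coe_set_eq]
      exact congrArg (· - 1) (hP P)
    exact h2
  rw [← hcard, ← Nat.card_coe_set_eq]
  refine Nat.card_le_card_of_injective (fun y => ⟨y.2.1, ?_⟩) ?_
  · rw [Set.mem_ofPred_eq, ← Nat.card_zpowers,
      ← Subgroup.eq_zpowers_of_prime_card hp.out (hP y.1) y.2.2.1 y.2.2.2]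
    exact hP y.1
  · rintro ⟨P, x, hx⟩ ⟨Q, y, hy⟩ h
    obtain rfl : x = y := congrArg Subtype.val h
    obtain rfl : P = Q := Sylow.ext (by
      rw [Subgroup.eq_zpowers_of_prime_card hp.out (hP P) hx.1 hx.2,
        Subgroup.eq_zpowers_of_prime_card hp.out (hP Q) hy.1 hy.2])
    rfl

theorem exists_card_mul_card_eq_of_card_sylow_eq_one {G : Type*} [Group G] [Finite G] {p : ℕ}
    [hp : Fact p.Prime] (hP : ∀ P : Sylow p G, Nat.card P = p) (h : Nat.card (Sylow p G) = 1) :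
    ∃ c m : ℕ, c * m = Nat.card G ∧ m ∣ p - 1 ∧
      (p - 1) * (c - p) ≤ p * (compositeElements G).ncard ∧
      (m ≠ 1 → ¬ m.Prime → c * m.totient ≤ (compositeElements G).ncard) := by
  have hsub : Subsingleton (Sylow p G) := (Nat.card_eq_one_iff_unique.1 h).1
  obtain ⟨P⟩ : Nonempty (Sylow p G) := inferInstance
  have : (P : Subgroup G).Normal := Sylow.normal_of_subsingleton P
  refine exists_card_mul_card_eq_of_normal hp.out (P : Subgroup G) (hP P) fun x hx => ?_
  obtain ⟨Q, hQ⟩ := exists_mem_sylow_of_orderOf_eq hx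
  exact hsub.elim Q P ▸ hQ

theorem Sylow.eq_of_le_normalizer {G : Type*} [Group G] {p : ℕ} [Fact p.Prime] {P Q : Sylow p G}
    (h : ∀ g ∈ P, g • Q = Q) : P = Q := by
  have h1 : (P : Subgroup G) ≤ Q := by
    rw [← IsPGroup.sylow_mem_fixedPoints_iff P.2]
    rintro ⟨g, hg⟩
    exact h g hg
  exact (Sylow.ext (P.3 Q.2 h1)).symm

/-! ### Sylow numbers for 13 and 7, and faithfulness -/

instance fact_prime_thirteen : Fact (Nat.Prime 13) := ⟨by norm_num⟩

instance fact_prime_seven : Fact (Nat.Prime 7) := ⟨by norm_num⟩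

section

variable {G : Type*} [Group G] [Finite G]

theorem card_sylow_thirteen (hG : Nat.card G = 1092) (hc : (compositeElements G).ncard ≤ 182) :
    Nat.card (Sylow 13 G) = 14 := by
  have hP : ∀ P : Sylow 13 G, Nat.card P = 13 :=
    fun P => P.card_eq_of_card_eq_mul (k := 84) (by omega) (by norm_num)
  obtain ⟨P⟩ : Nonempty (Sylow 13 G) := inferInstance
  have h1 : Nat.card (Sylow 13 G) ∣ 84 := by
    have h := (P : Subgroup G).card_mul_index
    have h' : Nat.card (P : Subgroup G) = 13 := hP P
    have h'' : (P : Subgroup G).index = 84 := by rw [h', hG] at h; omega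
    exact h'' ▸ P.card_dvd_index
  have h2 : Nat.card (Sylow 13 G) % 13 = 1 := card_sylow_modEq_one 13 G
  have h3 : Nat.card (Sylow 13 G) ≠ 1 := fun h => by
    obtain ⟨c, m, hcm, hm, hb, ht⟩ := exists_card_mul_card_eq_of_card_sylow_eq_one hP h
    have hm' : m ∈ Nat.divisors 12 := Nat.mem_divisors.2 ⟨hm, by norm_num⟩
    rw [show Nat.divisors 12 = {1, 2, 3, 4, 6, 12} by decide] at hm'
    simp only [Finset.mem_insert, Finset.mem_singleton] at hm'
    rcases hm' with rfl | rfl | rfl | rfl | rfl | rfl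
    -- For `m ≤ 4` the centralizer bound already exceeds 182 composite elements. For `m = 6` and `m
    -- = 12` the quotient bound gives 182 * 2 and 91 * 4, both 364.
    iterate 4 omega
    · have := ht (by norm_num) (by norm_num)
      rw [show Nat.totient 6 = 2 by decide] at this
      omega
    · have := ht (by norm_num) (by norm_num)
      rw [show Nat.totient 12 = 4 by decide] at this
      omega
  have h4 := Nat.le_of_dvd (by norm_num) h1
  interval_cases Nat.card (Sylow 13 G) <;> omega

theorem card_sylow_seven (hG : Nat.card G = 1092) (hc : (compositeElements G).ncard ≤ 182) :
    Nat.card (Sylow 7 G) = 78 := by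
  have hP : ∀ P : Sylow 7 G, Nat.card P = 7 :=
    fun P => P.card_eq_of_card_eq_mul (k := 156) (by omega) (by norm_num)
  obtain ⟨P⟩ : Nonempty (Sylow 7 G) := inferInstance
  have h1 : Nat.card (Sylow 7 G) ∣ 156 := by
    have h := (P : Subgroup G).card_mul_index
    have h' : Nat.card (P : Subgroup G) = 7 := hP P
    have h'' : (P : Subgroup G).index = 156 := by rw [h', hG] at h; omega
    exact h'' ▸ P.card_dvd_index
  have h2 : Nat.card (Sylow 7 G) % 7 = 1 := card_sylow_modEq_one 7 G
  have h3 : Nat.card (Sylow 7 G) ≠ 1 := fun h => by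
    obtain ⟨c, m, hcm, hm, hb, ht⟩ := exists_card_mul_card_eq_of_card_sylow_eq_one hP h
    have hm' : m ∈ Nat.divisors 6 := Nat.mem_divisors.2 ⟨hm, by norm_num⟩
    rw [show Nat.divisors 6 = {1, 2, 3, 6} by decide] at hm'
    simp only [Finset.mem_insert, Finset.mem_singleton] at hm'
    rcases hm' with rfl | rfl | rfl | rfl
    iterate 3 omega
    · have := ht (by norm_num) (by norm_num)
      rw [show Nat.totient 6 = 2 by decide] at this
      omega
  have h4 : Nat.card (Sylow 7 G) ∈ Nat.divisors 156 := Nat.mem_divisors.2 ⟨h1, by norm_num⟩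
  rw [show Nat.divisors 156 = {1, 2, 3, 4, 6, 12, 13, 26, 39, 52, 78, 156} by decide +kernel] at h4
  simp only [Finset.mem_insert, Finset.mem_singleton] at h4
  omega

/-- The conjugation action on the Sylow `13`-subgroups is faithful. -/
theorem toPermHom_sylow_thirteen_injective (hG : Nat.card G = 1092)
    (hc : (compositeElements G).ncard ≤ 182) :
    Function.Injective (MulAction.toPermHom G (Sylow 13 G)) := by
  rw [← MonoidHom.ker_eq_bot_iff, Subgroup.eq_bot_iff_forall]
  set K := (MulAction.toPermHom G (Sylow 13 G)).ker with hK
  have hfix : ∀ k ∈ K, ∀ Q : Sylow 13 G, k • Q = Q := fun k hk Q =>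
    congrArg (fun f : Equiv.Perm (Sylow 13 G) => f Q) (MonoidHom.mem_ker.1 hk)
  have hP : ∀ P : Sylow 13 G, Nat.card P = 13 :=
    fun P => P.card_eq_of_card_eq_mul (k := 84) (by omega) (by norm_num)
  have h14 := card_sylow_thirteen hG hc
  obtain ⟨P⟩ : Nonempty (Sylow 13 G) := inferInstance
  have hle : K ≤ Subgroup.normalizer (P : Subgroup G) := fun k hk =>
    Sylow.smul_eq_iff_mem_normalizer.1 (hfix k hk P)
  have hN : Nat.card (Subgroup.normalizer ((P : Subgroup G) : Set G)) = 78 := by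
    have h := Subgroup.card_mul_index (Subgroup.normalizer ((P : Subgroup G) : Set G))
    have h' : (Subgroup.normalizer ((P : Subgroup G) : Set G)).index = 14 := by
      rw [← h14]; exact P.card_eq_index_normalizer.symm
    rw [hG, h'] at h
    omega
  have hK78 : Nat.card K ∣ 78 := hN ▸ Subgroup.card_dvd_of_le hle
  -- Otherwise `K` contains a Sylow 13-subgroup `Q`; fixing every Sylow 13-subgroup, `Q` would equal
  -- each of them.
  have h13 : ¬ 13 ∣ Nat.card K := fun hdvd => by
    obtain ⟨k, hk⟩ := exists_prime_orderOf_dvd_card' 13 hdvd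
    have hk' : orderOf (k : G) = 13 := by rw [Subgroup.orderOf_coe, hk]
    obtain ⟨Q, hQ⟩ := exists_mem_sylow_of_orderOf_eq hk'
    have hQz := Subgroup.eq_zpowers_of_prime_card (by norm_num) (hP Q) hQ
      (fun h => by rw [h, orderOf_one] at hk'; omega)
    have hQK : (Q : Subgroup G) ≤ K := by rw [hQz]; exact (Subgroup.zpowers_le).2 k.2
    have : Nat.card (Sylow 13 G) ≤ 1 := by
      rw [Finite.card_le_one_iff_subsingleton]
      refine ⟨fun R S => ?_⟩
      rw [← Sylow.eq_of_le_normalizer (P := Q) (Q := R) fun g hg => hfix g (hQK hg) R,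
        ← Sylow.eq_of_le_normalizer (P := Q) (Q := S) fun g hg => hfix g (hQK hg) S]
    omega
  have hK6 : Nat.card K ≤ 6 := by
    have h1 : Nat.card K ∣ 6 := by
      refine Nat.Coprime.dvd_of_dvd_mul_left (k := Nat.card K) (m := 13) (n := 6) ?_ hK78
      exact ((Nat.Prime.coprime_iff_not_dvd (by norm_num)).2 h13).symm
    exact Nat.le_of_dvd (by norm_num) h1
  intro k hk
  by_contra hk1
  -- Conjugation permutes the at most 6 elements of `K`, so an element of order 7 acts trivially.
  have hcomm : ∀ x : G, orderOf x = 7 → Commute x k := by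
    intro x hx
    let f : G →* Equiv.Perm K := (MulAut.toPerm K).comp MulAut.conjNormal
    have h1 : orderOf (f x) ∣ 7 := hx ▸ orderOf_map_dvd f x
    have h2 : orderOf (f x) ∣ (Nat.card K).factorial := by
      rw [← Nat.card_perm]; exact orderOf_dvd_natCard _
    have h3 : orderOf (f x) = 1 := by
      refine ((Nat.dvd_prime (by norm_num)).1 h1).resolve_right fun h => ?_
      rw [h, Nat.Prime.dvd_factorial (by norm_num)] at h2
      omega
    have h4 : f x ⟨k, hk⟩ = ⟨k, hk⟩ := by rw [orderOf_eq_one_iff.1 h3]; rfl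
    have h5 : x * k * x⁻¹ = k := congrArg Subtype.val h4
    exact mul_inv_eq_iff_eq_mul.1 h5
  have hok : orderOf k ≤ 6 := by
    refine le_trans (Nat.le_of_dvd Nat.card_pos (Subgroup.orderOf_dvd_natCard K hk)) hK6
  have hok1 : orderOf k ≠ 1 := fun h => hk1 (orderOf_eq_one_iff.1 h)
  have hcop : Nat.Coprime 7 (orderOf k) := by
    rw [Nat.Prime.coprime_iff_not_dvd (by norm_num)]
    intro h
    have := Nat.le_of_dvd (orderOf_pos k) h
    omega
  have hle' : {x : G | orderOf x = 7}.ncard ≤ (compositeElements G).ncard := by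
    refine Set.ncard_le_ncard_of_injOn (fun x => x * k) (fun x hx => ?_)
      (fun x _ y _ h => mul_right_cancel h) (Set.toFinite _)
    have hx : orderOf x = 7 := hx
    have ho : orderOf (x * k) = 7 * orderOf k := by
      rw [(hcomm x hx).orderOf_mul_eq_mul_orderOf_of_coprime (by rw [hx]; exact hcop), hx]
    refine ⟨fun h => ?_, ?_⟩
    · rw [h, orderOf_one] at ho
      omega
    · rw [ho]
      exact Nat.not_prime_mul (by norm_num) hok1
  have h7 := card_sylow_mul_le_ncard_orderOf_eq (G := G) (p := 7)
    fun P => P.card_eq_of_card_eq_mul (k := 156) (by omega) (by norm_num)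
  -- There are at least 78 * 6 = 468 elements of order 7, against at most 182 composite ones.
  rw [card_sylow_seven hG hc] at h7
  omega

end

/-! ### Permutations of the projective line over `ZMod 13` -/

/-- The permutation `x ↦ a * x + b` of the projective line over `ZMod 13`, fixing the point
at infinity `none`. -/
def affinePerm (a : (ZMod 13)ˣ) (b : ZMod 13) : Equiv.Perm (Option (ZMod 13)) :=
  Equiv.optionCongr ((Units.mulLeft a).trans (Equiv.addRight b))

@[simp]
theorem affinePerm_none (a : (ZMod 13)ˣ) (b : ZMod 13) : affinePerm a b none = none := rfl

@[simp]
theorem affinePerm_some (a : (ZMod 13)ˣ) (b x : ZMod 13) :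
    affinePerm a b (some x) = some (a * x + b) := rfl

theorem affinePerm_mul (a a' : (ZMod 13)ˣ) (b b' : ZMod 13) :
    affinePerm a b * affinePerm a' b' = affinePerm (a * a') (a * b' + b) := by
  ext x : 1
  cases x with
  | none => rfl
  | some x =>
    simp only [Equiv.Perm.mul_apply, affinePerm_some, Units.val_mul, Option.some.injEq]
    ring

theorem affinePerm_one_zero : affinePerm 1 0 = 1 := by
  ext x : 1
  cases x <;> simp

theorem affinePerm_injective {a a' : (ZMod 13)ˣ} {b b' : ZMod 13}
    (h : affinePerm a b = affinePerm a' b') : a = a' ∧ b = b' := by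
  have h0 := congrArg (fun m : Equiv.Perm (Option (ZMod 13)) => m (some 0)) h
  have h1 := congrArg (fun m : Equiv.Perm (Option (ZMod 13)) => m (some 1)) h
  simp only [affinePerm_some, mul_zero, zero_add, mul_one, Option.some.injEq] at h0 h1
  exact ⟨Units.ext (by rw [h0] at h1; exact add_right_cancel h1), h0⟩

theorem affinePerm_one_one_pow (n : ℕ) : affinePerm 1 1 ^ n = affinePerm 1 n := by
  induction n with
  | zero => simp [affinePerm_one_zero]
  | succ n ih => rw [pow_succ, ih, affinePerm_mul]; simp [add_comm]

/-- The inversion `x ↦ x⁻¹` of the projective line over `ZMod 13`. -/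
def inversionFun : Option (ZMod 13) → Option (ZMod 13)
  | none => some 0
  | some x => if x = 0 then none else some x⁻¹

theorem inversionFun_involutive : Function.Involutive inversionFun := by
  rintro (_ | x)
  · simp [inversionFun]
  · by_cases hx : x = 0 <;> simp [inversionFun, hx]

/-- The inversion `x ↦ x⁻¹` as a permutation of the projective line over `ZMod 13`. -/
def inversionPerm : Equiv.Perm (Option (ZMod 13)) := inversionFun_involutive.toPerm

/-- The permutations of the projective line over `ZMod 13` induced by matrices of square
determinant, listed by their Bruhat decomposition. -/
def squareMoebius : Set (Equiv.Perm (Option (ZMod 13))) :=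
  {m | (∃ a b, a ^ 6 = 1 ∧ m = affinePerm a b) ∨
    ∃ y a b, a ^ 6 = 1 ∧ m = affinePerm 1 y * inversionPerm * affinePerm a b}

/-- The map exchanging `none` and `0` with `1 ↦ c`, `2 ↦ d` and `4 * x ↦ b * (image of x)`. -/
def swapFun (b c d : ZMod 13) : Option (ZMod 13) → Option (ZMod 13)
  | none => some 0
  | some x =>
    if x = 0 then none else if x = 1 then some c else if x = 4 then some (b * c)
    else if x = 3 then some (b ^ 2 * c) else if x = 12 then some (b ^ 3 * c)
    else if x = 9 then some (b ^ 4 * c) else if x = 10 then some (b ^ 5 * c)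
    else if x = 2 then some d else if x = 8 then some (b * d)
    else if x = 6 then some (b ^ 2 * d) else if x = 11 then some (b ^ 3 * d)
    else if x = 5 then some (b ^ 4 * d) else some (b ^ 5 * d)

/-- The translation by `j` on the projective line. -/
def translateOption (j : ZMod 13) : Option (ZMod 13) → Option (ZMod 13) := Option.map (· + j)

-- The word `w τ₋c w τ₁ w`, with `w = swapFun b c d` and `τ` the translations, sends infinity
-- through 0, 1, `c`, 0 back to infinity. It must therefore be affine with square multiplier, and
-- its values at 0, 1 and 2 already rule out every parameter choice except that of the inversion.
set_option synthInstance.maxHeartbeats 400000 in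
set_option synthInstance.maxSize 1000 in
theorem swapFun_rigid : ∀ b : ZMod 13, b ^ 6 = 1 → ∀ c : ZMod 13, c = 1 ∨ c = 2 →
    ∀ d : ZMod 13, d ≠ 0 → ∀ a : ZMod 13, a ^ 6 = 1 → ∀ e : ZMod 13,
    swapFun b c d (translateOption (-c) (swapFun b c d (translateOption 1 (swapFun b c d (some 0))))) =
      some e →
    swapFun b c d (translateOption (-c) (swapFun b c d (translateOption 1 (swapFun b c d (some 1))))) =
      some (a * 1 + e) →
    swapFun b c d (translateOption (-c) (swapFun b c d (translateOption 1 (swapFun b c d (some 2))))) =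
      some (a * 2 + e) →
    b = 10 ∧ c = 1 ∧ d = 7 := by
  decide +kernel

theorem swapFun_eq_inversionFun : ∀ x, swapFun 10 1 7 x = inversionFun x := by
  decide +kernel

/-- Multiplication by 4 has two orbits on the nonzero residues, the squares (from 1) and the
nonsquares (from 2), so the semilinearity `h4` determines `f` from `c` and `d`. -/
theorem eq_swapFun {f : Option (ZMod 13) → Option (ZMod 13)} {b c d : ZMod 13}
    (hn : f none = some 0) (h0 : f (some 0) = none) (h1 : f (some 1) = some c)
    (h2 : f (some 2) = some d)
    (h4 : ∀ x y, f (some x) = some y → f (some (4 * x)) = some (b * y)) :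
    ∀ x, f x = swapFun b c d x := by
  have e1 := h4 _ _ h1
  have e2 := h4 _ _ e1
  have e3 := h4 _ _ e2
  have e4 := h4 _ _ e3
  have e5 := h4 _ _ e4
  have o1 := h4 _ _ h2
  have o2 := h4 _ _ o1
  have o3 := h4 _ _ o2
  have o4 := h4 _ _ o3
  have o5 := h4 _ _ o4
  rw [show (4 * 1 : ZMod 13) = 4 by decide] at e1 e2 e3 e4 e5
  rw [show (4 * 4 : ZMod 13) = 3 by decide] at e2 e3 e4 e5
  rw [show (4 * 3 : ZMod 13) = 12 by decide] at e3 e4 e5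
  rw [show (4 * 12 : ZMod 13) = 9 by decide] at e4 e5
  rw [show (4 * 9 : ZMod 13) = 10 by decide] at e5
  rw [show (4 * 2 : ZMod 13) = 8 by decide] at o1 o2 o3 o4 o5
  rw [show (4 * 8 : ZMod 13) = 6 by decide] at o2 o3 o4 o5
  rw [show (4 * 6 : ZMod 13) = 11 by decide] at o3 o4 o5
  rw [show (4 * 11 : ZMod 13) = 5 by decide] at o4 o5
  rw [show (4 * 5 : ZMod 13) = 7 by decide] at o5
  rintro (_ | x)
  · exact hn
  · have hx : ∀ x : ZMod 13, x = 0 ∨ x = 1 ∨ x = 4 ∨ x = 3 ∨ x = 12 ∨ x = 9 ∨ x = 10 ∨ x = 2 ∨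
        x = 8 ∨ x = 6 ∨ x = 11 ∨ x = 5 ∨ x = 7 := by decide
    have expand : ∀ y : ZMod 13, b ^ 2 * y = b * (b * y) ∧ b ^ 3 * y = b * (b * (b * y)) ∧
        b ^ 4 * y = b * (b * (b * (b * y))) ∧ b ^ 5 * y = b * (b * (b * (b * (b * y)))) :=
      fun y => ⟨by ring, by ring, by ring, by ring⟩
    obtain ⟨c2, c3, c4, c5⟩ := expand c
    obtain ⟨d2, d3, d4, d5⟩ := expand d
    rw [← c2] at e2
    rw [← c3] at e3
    rw [← c4] at e4
    rw [← c5] at e5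
    rw [← d2] at o2
    rw [← d3] at o3
    rw [← d4] at o4
    rw [← d5] at o5
    rcases hx x with rfl | rfl | rfl | rfl | rfl | rfl | rfl | rfl | rfl | rfl | rfl | rfl | rfl
    · exact h0
    · exact h1
    · exact e1
    · exact e2
    · exact e3
    · exact e4
    · exact e5
    · exact h2
    · exact o1
    · exact o2
    · exact o3
    · exact o4
    · exact o5

/-- The solutions of `s ^ 6 = 1` are the nonzero squares, and 1 and 2 represent the two square
classes. -/
theorem exists_pow_six_mul_eq : ∀ c : ZMod 13, c ≠ 0 →
    ∃ s : (ZMod 13)ˣ, s ^ 6 = 1 ∧ (s * c = 1 ∨ s * c = 2) := by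
  intro c hc
  have h : ∀ c : ZMod 13, c ≠ 0 → ∃ s : ZMod 13, s ^ 6 = 1 ∧ (s * c = 1 ∨ s * c = 2) := by decide
  obtain ⟨s, hs, hsc⟩ := h c hc
  have hs0 : s ≠ 0 := fun h => by rw [h] at hs; exact absurd hs (by decide)
  exact ⟨Units.mk0 s hs0, Units.ext (by simpa using hs), by simpa using hsc⟩

theorem ncard_pow_six_eq_one : {a : (ZMod 13)ˣ | a ^ 6 = 1}.ncard = 6 := by
  rw [Set.ncard_eq_toFinset_card']
  decide +kernel

/-! ### Rigidity of the permutation group -/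

section

variable {M : Subgroup (Equiv.Perm (Option (ZMod 13)))}

theorem affinePerm_one_mem (hT : affinePerm 1 1 ∈ M) (b : ZMod 13) : affinePerm 1 b ∈ M := by
  have := M.pow_mem hT b.val
  rwa [affinePerm_one_one_pow, ZMod.natCast_zmod_val] at this

/-- The multipliers occurring in a permutation group of the projective line. -/
def multipliers (M : Subgroup (Equiv.Perm (Option (ZMod 13)))) : Subgroup (ZMod 13)ˣ where
  carrier := {a | affinePerm a 0 ∈ M}
  one_mem' := by
    have := M.one_mem
    rwa [← affinePerm_one_zero] at this
  mul_mem' {a b} ha hb := by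
    have := M.mul_mem ha hb
    rw [affinePerm_mul] at this
    simpa using this
  inv_mem' {a} ha := by
    have h : (affinePerm a 0)⁻¹ = affinePerm a⁻¹ 0 := by
      rw [inv_eq_iff_mul_eq_one, affinePerm_mul, mul_inv_cancel]
      simp [affinePerm_one_zero]
    have := M.inv_mem ha
    rwa [h] at this

theorem affinePerm_mem_iff (hT : affinePerm 1 1 ∈ M) (a : (ZMod 13)ˣ) (b : ZMod 13) :
    affinePerm a b ∈ M ↔ a ∈ multipliers M := by
  have h : affinePerm a b = affinePerm 1 b * affinePerm a 0 := by simp [affinePerm_mul]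
  rw [h, M.mul_mem_cancel_left (affinePerm_one_mem hT b)]
  rfl

/-- `M` is transitive with affine point stabilizer, so 1092 = 14 * 13 * 6 leaves 6 multipliers,
which must be exactly the six solutions of `a ^ 6 = 1`. -/
theorem mem_multipliers_iff (hM : Nat.card M = 1092) (hT : affinePerm 1 1 ∈ M)
    (haff : ∀ m ∈ M, m none = none → ∃ a b, m = affinePerm a b)
    {m₀ : Equiv.Perm (Option (ZMod 13))} (hm₀ : m₀ ∈ M) (h₀ : m₀ none = some 0)
    (a : (ZMod 13)ˣ) : a ∈ multipliers M ↔ a ^ 6 = 1 := by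
  -- Coset representatives of the stabilizer of infinity, indexed by the image of infinity.
  let t : Option (ZMod 13) → Equiv.Perm (Option (ZMod 13)) :=
    fun y => y.elim 1 fun y => affinePerm 1 y * m₀
  have ht : ∀ y, t y ∈ M := by
    rintro (_ | y)
    · exact M.one_mem
    · exact M.mul_mem (affinePerm_one_mem hT y) hm₀
  have htn : ∀ y, t y none = y := by
    rintro (_ | y)
    · rfl
    · simp [t, h₀]
  let F : Option (ZMod 13) × multipliers M × ZMod 13 → M := fun p =>
    ⟨t p.1 * affinePerm p.2.1 p.2.2,
      M.mul_mem (ht p.1) ((affinePerm_mem_iff hT _ _).2 p.2.1.2)⟩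
  have hF : Function.Bijective F := by
    constructor
    · rintro ⟨y, a, b⟩ ⟨y', a', b'⟩ h
      have h' : t y * affinePerm a b = t y' * affinePerm a' b' := congrArg Subtype.val h
      obtain rfl : y = y' := by
        have := congrArg (fun m : Equiv.Perm (Option (ZMod 13)) => m none) h'
        simpa [htn] using this
      obtain ⟨h1, rfl⟩ := affinePerm_injective (mul_left_cancel h')
      obtain rfl := Subtype.ext h1
      rfl
    · rintro ⟨m, hm⟩
      have hmem : (t (m none))⁻¹ * m ∈ M := M.mul_mem (M.inv_mem (ht _)) hm
      obtain ⟨a, b, hab⟩ := haff _ hmem (by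
        rw [Equiv.Perm.mul_apply, Equiv.Perm.inv_eq_iff_eq, htn])
      rw [hab, affinePerm_mem_iff hT] at hmem
      refine ⟨⟨m none, ⟨a, hmem⟩, b⟩, Subtype.ext ?_⟩
      simp only [F]
      rw [← hab, mul_inv_cancel_left]
  have hcard := Nat.card_congr (Equiv.ofBijective F hF)
  rw [Nat.card_prod, Nat.card_prod, hM, Nat.card_eq_fintype_card (α := Option (ZMod 13)),
    Fintype.card_option, Nat.card_eq_fintype_card (α := ZMod 13), ZMod.card] at hcard
  have h6 : Nat.card (multipliers M) = 6 := by omega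
  have hsub : (multipliers M : Set (ZMod 13)ˣ) ⊆ {a | a ^ 6 = 1} := fun a ha => by
    have := pow_card_eq_one' (x := (⟨a, ha⟩ : multipliers M))
    rw [h6] at this
    exact congrArg Subtype.val this
  have heq := Set.eq_of_subset_of_ncard_le hsub (by
    rw [ncard_pow_six_eq_one]; exact h6.ge) (Set.toFinite _)
  exact Set.ext_iff.1 heq a

/-- A permutation group of order `1092` on the projective line over `ZMod 13`, containing the
translations and with affine stabilizer of infinity, is determined. -/
theorem coe_eq_squareMoebius (hM : Nat.card M = 1092) (hT : affinePerm 1 1 ∈ M)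
    (haff : ∀ m ∈ M, m none = none → ∃ a b, m = affinePerm a b)
    (htrans : ∃ m ∈ M, m none ≠ none) : (M : Set _) = squareMoebius := by
  obtain ⟨m₀, hm₀, h₀⟩ : ∃ m ∈ M, m none = some 0 := by
    obtain ⟨m, hm, hne⟩ := htrans
    obtain ⟨y, hy⟩ := Option.ne_none_iff_exists'.1 hne
    exact ⟨affinePerm 1 (-y) * m, M.mul_mem (affinePerm_one_mem hT _) hm, by simp [hy]⟩
  have hA : ∀ a b, affinePerm a b ∈ M ↔ a ^ 6 = 1 := fun a b =>
    (affinePerm_mem_iff hT a b).trans (mem_multipliers_iff hM hT haff hm₀ h₀ a)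
  obtain ⟨v, hv, hvn, hv0⟩ : ∃ m ∈ M, m none = some 0 ∧ m (some 0) = none := by
    have hne : m₀⁻¹ none ≠ none := fun h => by
      rw [Equiv.Perm.inv_eq_iff_eq, h₀] at h
      cases h
    obtain ⟨z, hz⟩ := Option.ne_none_iff_exists'.1 hne
    refine ⟨m₀ * affinePerm 1 z, M.mul_mem hm₀ (affinePerm_one_mem hT z), by simp [h₀], ?_⟩
    rw [Equiv.Perm.mul_apply, affinePerm_some, mul_zero, zero_add, ← Equiv.Perm.eq_inv_iff_eq, hz]
  have hval : ∀ m : Equiv.Perm (Option (ZMod 13)), m none = some 0 → m (some 0) = none →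
      ∀ x, x ≠ 0 → ∃ y, y ≠ 0 ∧ m (some x) = some y := by
    intro m hn h0 x hx
    have hne : m (some x) ≠ none := fun h => hx (by simpa using m.injective (h.trans h0.symm))
    obtain ⟨y, hy⟩ := Option.ne_none_iff_exists'.1 hne
    refine ⟨y, ?_, hy⟩
    rintro rfl
    simpa using m.injective (hy.trans hn.symm)
  -- Composing with a square scaling normalizes the value at 1 to a square class representative.
  obtain ⟨w, hw, hwn, hw0, c, hc, hw1⟩ : ∃ m ∈ M, m none = some 0 ∧ m (some 0) = none ∧
      ∃ c : ZMod 13, (c = 1 ∨ c = 2) ∧ m (some 1) = some c := by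
    obtain ⟨c, hc0, hc⟩ := hval v hvn hv0 1 (by decide)
    obtain ⟨s, hs, hsc⟩ := exists_pow_six_mul_eq c hc0
    exact ⟨affinePerm s 0 * v, M.mul_mem ((hA s 0).2 hs) hv, by simp [hvn], by simp [hv0],
      s * c, hsc, by simp [hc]⟩
  obtain ⟨d, hd0, hd⟩ := hval w hwn hw0 2 (by decide)
  obtain ⟨u, hu⟩ : ∃ u : (ZMod 13)ˣ, (u : ZMod 13) = 4 :=
    ⟨Units.mk0 4 (by decide), rfl⟩
  have hu6 : u ^ 6 = 1 := Units.ext (by rw [Units.val_pow_eq_pow_val, hu]; decide)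
  -- `w` swaps infinity and 0, so conjugating the scaling by 4 gives a map fixing both, hence again
  -- a scaling, by some `b`.
  have hconj : w * affinePerm u 0 * w⁻¹ ∈ M :=
    M.mul_mem (M.mul_mem hw ((hA u 0).2 hu6)) (M.inv_mem hw)
  have hw0' : w⁻¹ none = some 0 := by rw [Equiv.Perm.inv_eq_iff_eq, hw0]
  obtain ⟨b, b₀, hb⟩ := haff _ hconj (by
    rw [Equiv.Perm.mul_apply, Equiv.Perm.mul_apply, hw0', affinePerm_some, mul_zero, zero_add, hw0])
  rw [mul_inv_eq_iff_eq_mul] at hb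
  have hbw : ∀ x, w (affinePerm u 0 x) = affinePerm b b₀ (w x) := fun x =>
    congrArg (fun m : Equiv.Perm (Option (ZMod 13)) => m x) hb
  have hb₀ : b₀ = 0 := by
    have := hbw none
    simpa [hwn, eq_comm] using this
  subst hb₀
  have hb6 : b ^ 6 = 1 := by
    rw [hb, mul_inv_cancel_right] at hconj
    exact (hA b 0).1 hconj
  have h4 : ∀ x y, w (some x) = some y → w (some (4 * x)) = some (b * y) := by
    intro x y hxy
    have := hbw (some x)
    rwa [hxy, affinePerm_some, affinePerm_some, add_zero, add_zero, hu] at this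
  have hfun := eq_swapFun hwn hw0 hw1 hd h4
  have htr : ∀ j x, affinePerm 1 j x = translateOption j x := by
    rintro j (_ | x)
    · rfl
    · simp [translateOption]
  have hg : w * affinePerm 1 (-c) * w * affinePerm 1 1 * w ∈ M :=
    M.mul_mem (M.mul_mem (M.mul_mem (M.mul_mem hw (affinePerm_one_mem hT _)) hw) hT) hw
  obtain ⟨a, e, hae⟩ := haff _ hg (by simp [hwn, hw1, hw0])
  have ha6 : a ^ 6 = 1 := (hA a e).1 (hae ▸ hg)
  have hgval : ∀ x, swapFun b c d (translateOption (-c) (swapFun b c d (translateOption 1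
      (swapFun b c d (some x))))) = some (a * x + e) := by
    intro x
    have := congrArg (fun m : Equiv.Perm (Option (ZMod 13)) => m (some x)) hae
    simpa only [Equiv.Perm.mul_apply, affinePerm_some, htr, hfun] using this
  have hcast : ∀ {a : (ZMod 13)ˣ}, a ^ 6 = 1 → (a : ZMod 13) ^ 6 = 1 := fun h => by
    rw [← Units.val_pow_eq_pow_val, h, Units.val_one]
  obtain ⟨hb', rfl, rfl⟩ := swapFun_rigid b (hcast hb6) c hc d hd0 a (hcast ha6) e
    (by simpa using hgval 0) (hgval 1) (hgval 2)
  have hwinv : w = inversionPerm := by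
    ext x : 1
    rw [hfun, hb', swapFun_eq_inversionFun]
    rfl
  subst hwinv
  ext m
  constructor
  · intro hm
    by_cases hmn : m none = none
    · obtain ⟨a, b, rfl⟩ := haff m hm hmn
      exact Or.inl ⟨a, b, (hA a b).1 hm, rfl⟩
    · obtain ⟨y, hy⟩ := Option.ne_none_iff_exists'.1 hmn
      have hmem : (affinePerm 1 y * inversionPerm)⁻¹ * m ∈ M :=
        M.mul_mem (M.inv_mem (M.mul_mem (affinePerm_one_mem hT y) hw)) hm
      obtain ⟨a, b, hab⟩ := haff _ hmem (by
        rw [Equiv.Perm.mul_apply, Equiv.Perm.inv_eq_iff_eq, hy]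
        simp [hwn])
      exact Or.inr ⟨y, a, b, (hA a b).1 (hab ▸ hmem), by rw [← hab, mul_inv_cancel_left]⟩
  · rintro (⟨a, b, ha, rfl⟩ | ⟨y, a, b, ha, rfl⟩)
    · exact (hA a b).2 ha
    · exact M.mul_mem (M.mul_mem (affinePerm_one_mem hT y) hw) ((hA a b).2 ha)

end

/-! ### Labelling the Sylow 13-subgroups by the projective line -/

/-- `P` fixes itself and no other Sylow 13-subgroup; having prime order, it permutes the other 13
freely, so they form one orbit, labelled by exponents of `t`. -/
theorem exists_equiv_sylow_thirteen {G : Type*} [Group G] [Finite G]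
    (h14 : Nat.card (Sylow 13 G) = 14) (hP : ∀ P : Sylow 13 G, Nat.card P = 13) :
    ∃ (P : Sylow 13 G) (t : G) (e : Option (ZMod 13) ≃ Sylow 13 G),
      (P : Subgroup G) = Subgroup.zpowers t ∧ orderOf t = 13 ∧ e none = P ∧
      ∀ i : ZMod 13, e (some i) = t ^ i.val • e (some 0) := by
  obtain ⟨P⟩ : Nonempty (Sylow 13 G) := inferInstance
  have hnt : Nontrivial (Sylow 13 G) := by
    rw [← Finite.one_lt_card_iff_nontrivial, h14]; norm_num
  obtain ⟨Q, hQ⟩ := exists_ne P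
  obtain ⟨t, ht⟩ := exists_prime_orderOf_dvd_card' (G := P) 13 (hP P).symm.dvd
  have ht' : orderOf (t : G) = 13 := (Subgroup.orderOf_coe t).trans ht
  have hgen : ∀ g ∈ P, g ≠ 1 → (P : Subgroup G) = Subgroup.zpowers g := fun g hg h1 =>
    Subgroup.eq_zpowers_of_prime_card (by norm_num) (hP P) hg h1
  have htP : ∀ n : ℕ, (t : G) ^ n ∈ P := fun n => (P : Subgroup G).pow_mem t.2 n
  have hfixP : ∀ g ∈ P, g • P = P := fun g hg =>
    Sylow.smul_eq_iff_mem_normalizer.2 (Subgroup.le_normalizer hg)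
  have hmove : ∀ g ∈ P, g ≠ 1 → g • Q ≠ Q := fun g hg h1 h => by
    refine hQ (Sylow.eq_of_le_normalizer (P := P) fun k hk => ?_).symm
    have hk' : k ∈ Subgroup.zpowers g := hgen g hg h1 ▸ hk
    have hle : Subgroup.zpowers g ≤ MulAction.stabilizer G Q := (Subgroup.zpowers_le).2 h
    exact hle hk'
  let f : Option (ZMod 13) → Sylow 13 G := fun x => x.elim P fun i => (t : G) ^ i.val • Q
  have hf : Function.Injective f := by
    have hne : ∀ i : ZMod 13, P ≠ (t : G) ^ i.val • Q := fun i h => by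
      exact hQ (smul_left_cancel _ ((hfixP _ (htP i.val)).trans h)).symm
    have key : ∀ i j : ZMod 13, i.val ≤ j.val → (t : G) ^ i.val • Q = (t : G) ^ j.val • Q →
        i = j := by
      intro i j hij h
      obtain ⟨k, hk⟩ := Nat.exists_eq_add_of_le hij
      rw [hk, pow_add, mul_smul] at h
      have h1 := (smul_left_cancel _ h).symm
      by_contra hne
      refine hmove _ (htP k) (fun hk1 => hne (ZMod.val_injective 13 ?_)) h1
      have hdvd := orderOf_dvd_of_pow_eq_one hk1
      rw [ht'] at hdvd
      have := ZMod.val_lt j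
      have := ZMod.val_lt i
      omega
    rintro (_ | i) (_ | j) h
    · rfl
    · exact absurd h (hne j)
    · exact absurd h.symm (hne i)
    · rcases le_total i.val j.val with hij | hij
      · rw [key i j hij h]
      · rw [key j i hij h.symm]
  have hbij : Function.Bijective f := by
    refine (Nat.bijective_iff_injective_and_card f).2 ⟨hf, ?_⟩
    rw [h14, Nat.card_eq_fintype_card, Fintype.card_option, ZMod.card]
  refine ⟨P, t, Equiv.ofBijective f hbij, hgen t t.2 ?_, ht', rfl, fun i => ?_⟩
  · intro h
    rw [h, orderOf_one] at ht'
    omega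
  · simp [f]

/-- A group of order `1092` with few elements of composite order acts faithfully on the projective
line over `ZMod 13`, with image the group of fractional linear maps of square determinant. -/
theorem exists_hom_range_eq_squareMoebius {G : Type*} [Group G] [Finite G]
    (hG : Nat.card G = 1092) (hc : (compositeElements G).ncard ≤ 182) :
    ∃ φ : G →* Equiv.Perm (Option (ZMod 13)), Function.Injective φ ∧
      (φ.range : Set _) = squareMoebius := by
  have hP : ∀ P : Sylow 13 G, Nat.card P = 13 :=
    fun P => P.card_eq_of_card_eq_mul (k := 84) (by omega) (by norm_num)
  obtain ⟨P, t, e, hPt, ht, hen, hes⟩ :=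
    exists_equiv_sylow_thirteen (card_sylow_thirteen hG hc) hP
  let φ : G →* Equiv.Perm (Option (ZMod 13)) :=
    (e.symm.permCongrHom : _ →* _).comp (MulAction.toPermHom G (Sylow 13 G))
  have hφ : ∀ g x, e (φ g x) = g • e x := fun g x => by
    simp [φ, Equiv.permCongrHom_coe, Equiv.permCongr_apply]
  have hinj : Function.Injective φ :=
    e.symm.permCongrHom.injective.comp (toPermHom_sylow_thirteen_injective hG hc)
  have htpow : ∀ (n : ℕ) (i : ZMod 13), e (some (n + i)) = t ^ n • e (some i) := by
    intro n i
    have h : t ^ ((n : ZMod 13) + i).val = t ^ (n + i.val) := by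
      rw [pow_eq_pow_iff_modEq, ht, ← ZMod.natCast_eq_natCast_iff]
      simp
    rw [hes, h, hes i, pow_add, mul_smul]
  have hTt : φ t = affinePerm 1 1 := by
    ext x : 1
    apply e.injective
    rw [hφ]
    cases x with
    | none =>
      rw [affinePerm_none, hen]
      refine Sylow.smul_eq_iff_mem_normalizer.2 (Subgroup.le_normalizer ?_)
      rw [hPt]
      exact Subgroup.mem_zpowers t
    | some i =>
      have := htpow 1 i
      rw [pow_one] at this
      rw [← this, affinePerm_some]
      simp [add_comm]
  refine ⟨φ, hinj, coe_eq_squareMoebius ?_ ⟨t, hTt⟩ ?_ ?_⟩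
  · rw [← hG]
    exact Nat.card_congr (MonoidHom.ofInjective hinj).toEquiv.symm
  · rintro _ ⟨g, rfl⟩ hg
    have hgP : g • P = P := by rw [← hen, ← hφ, hg]
    have hmem : g * t * g⁻¹ ∈ Subgroup.zpowers t := by
      have h1 := Sylow.smul_eq_iff_mem_normalizer.1 hgP
      rw [← hPt]
      exact (Subgroup.mem_normalizer_iff.1 h1 t).1 (hPt ▸ Subgroup.mem_zpowers t)
    -- An element fixing infinity normalizes `P`, and the exponent `n` in `g * t * g⁻¹ = t ^ n`
    -- becomes the multiplier of its affine map.
    obtain ⟨n, hn⟩ := (mem_powers_iff_mem_zpowers.2 hmem : g * t * g⁻¹ ∈ Submonoid.powers t)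
    have hn : t ^ n = g * t * g⁻¹ := hn
    have hne : φ g (some 0) ≠ none := fun h => by
      have := (φ g).injective (h.trans hg.symm)
      cases this
    obtain ⟨b, hb⟩ := Option.ne_none_iff_exists'.1 hne
    have hval : ∀ i : ZMod 13, φ g (some i) = some (n * i + b) := by
      intro i
      apply e.injective
      have h1 : g * t ^ i.val = t ^ (n * i.val) * g := by
        rw [pow_mul, hn, conj_pow, inv_mul_cancel_right]
      have h2 := htpow (n * i.val) b
      rw [Nat.cast_mul, ZMod.natCast_zmod_val] at h2
      rw [hφ, hes, ← mul_smul, h1, mul_smul, ← hφ, hb, h2]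
    have hn0 : (n : ZMod 13) ≠ 0 := fun h => by
      have h0 := hval 0
      have h1 := hval 1
      rw [h, zero_mul] at h0 h1
      have := (φ g).injective (h0.trans h1.symm)
      simp at this
    refine ⟨Units.mk0 n hn0, b, ?_⟩
    ext x : 1
    cases x with
    | none => exact hg
    | some i => rw [hval]; rfl
  · obtain ⟨g, hg⟩ := MulAction.exists_smul_eq G (e none) (e (some 0))
    refine ⟨φ g, ⟨g, rfl⟩, fun h => ?_⟩
    rw [← hφ, h] at hg
    simpa using e.injective hg

/-! ### Element orders in `L213` from traces -/

/-- The sequence with `A ^ (n + 1) = u (n + 1) • A - u n • 1` for every `2 × 2` matrix `A` of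
determinant one and trace `t`. -/
def tracePow {R : Type*} [CommRing R] (t : R) : ℕ → R
  | 0 => 0
  | 1 => 1
  | n + 2 => t * tracePow t (n + 1) - tracePow t n

/-- Cayley–Hamilton, `A² = tA - 1`, and induction. -/
theorem Matrix.SpecialLinearGroup.coe_pow_succ_eq {R : Type*} [CommRing R]
    (A : Matrix.SpecialLinearGroup (Fin 2) R) (n : ℕ) :
    (A : Matrix (Fin 2) (Fin 2) R) ^ (n + 1) =
      tracePow (A : Matrix (Fin 2) (Fin 2) R).trace (n + 1) • (A : Matrix (Fin 2) (Fin 2) R) -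
        tracePow (A : Matrix (Fin 2) (Fin 2) R).trace n • 1 := by
  have hsq : (A : Matrix (Fin 2) (Fin 2) R) * A =
      (A : Matrix (Fin 2) (Fin 2) R).trace • (A : Matrix (Fin 2) (Fin 2) R) - 1 := by
    have hdet := A.det_coe
    rw [Matrix.det_fin_two] at hdet
    ext i j
    fin_cases i <;> fin_cases j <;>
      simp [Matrix.mul_apply, Fin.sum_univ_two, Matrix.trace_fin_two] <;>
      first | ring1 | linear_combination -hdet
  induction n with
  | zero => simp [tracePow]
  | succ n ih =>
    rw [pow_succ, ih, sub_mul, smul_mul_assoc, hsq, tracePow]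
    simp only [smul_mul_assoc, one_mul, smul_sub, smul_smul, sub_smul]
    rw [mul_comm]
    abel

/-- A power is a combination of `A` and the identity; as `A` is not central, it is central exactly
when the coefficient of `A` vanishes. -/
theorem Matrix.SpecialLinearGroup.mk_pow_eq_one_iff {K : Type*} [Field K]
    {A : Matrix.SpecialLinearGroup (Fin 2) K} (hA : A ∉ Subgroup.center _) (n : ℕ) :
    (QuotientGroup.mk A : Matrix.ProjectiveSpecialLinearGroup (Fin 2) K) ^ (n + 1) = 1 ↔
      tracePow (A : Matrix (Fin 2) (Fin 2) K).trace (n + 1) = 0 := by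
  rw [← QuotientGroup.mk_pow, QuotientGroup.eq_one_iff]
  have hpow := A.coe_pow_succ_eq n
  constructor
  · intro h
    by_contra hu
    refine hA (Subgroup.mem_center_iff.2 fun g => Subtype.ext ?_)
    have h1 := congrArg Subtype.val (Subgroup.mem_center_iff.1 h g)
    simp only [Matrix.SpecialLinearGroup.coe_mul, Matrix.SpecialLinearGroup.coe_pow, hpow,
      mul_sub, sub_mul, mul_smul_comm, smul_mul_assoc, mul_one, one_mul] at h1
    exact smul_right_injective _ hu (sub_left_injective h1)
  · intro h
    refine Subgroup.mem_center_iff.2 fun g => Subtype.ext ?_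
    simp only [Matrix.SpecialLinearGroup.coe_mul, Matrix.SpecialLinearGroup.coe_pow, hpow, h,
      mul_sub, sub_mul, mul_smul_comm, smul_mul_assoc, mul_one, one_mul, zero_smul,
      mul_zero, zero_mul]

theorem tracePow_prime_cases : ∀ t : ZMod 13, ¬ (t = 4 ∨ t = 9) →
    tracePow t 2 = 0 ∨ tracePow t 3 = 0 ∨ tracePow t 7 = 0 ∨ tracePow t 13 = 0 := by
  decide +kernel

/-- With eigenvalues `λ` and `λ⁻¹`, projective order 6 means that `λ²` is a primitive sixth root of
unity, so `t² - 2 = 1` and `t = ±4`. -/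
theorem tracePow_six_cases : ∀ t : ZMod 13, (t = 4 ∨ t = 9) →
    tracePow t 6 = 0 ∧ tracePow t 2 ≠ 0 ∧ tracePow t 3 ≠ 0 := by
  decide +kernel

theorem orderOf_mk_eq_six {A : Matrix.SpecialLinearGroup (Fin 2) (ZMod 13)}
    (hA : A ∉ Subgroup.center _)
    (ht : (A : Matrix (Fin 2) (Fin 2) (ZMod 13)).trace = 4 ∨
      (A : Matrix (Fin 2) (Fin 2) (ZMod 13)).trace = 9) :
    orderOf (QuotientGroup.mk A : L213) = 6 := by
  obtain ⟨h6, h2, h3⟩ := tracePow_six_cases _ ht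
  have h2' := (Matrix.SpecialLinearGroup.mk_pow_eq_one_iff hA 1).not.2 h2
  have h3' := (Matrix.SpecialLinearGroup.mk_pow_eq_one_iff hA 2).not.2 h3
  have hd := orderOf_dvd_of_pow_eq_one ((Matrix.SpecialLinearGroup.mk_pow_eq_one_iff hA 5).2 h6)
  have hd' : orderOf (QuotientGroup.mk A : L213) ∈ Nat.divisors 6 :=
    Nat.mem_divisors.2 ⟨hd, by norm_num⟩
  rw [show Nat.divisors 6 = {1, 2, 3, 6} by decide] at hd'
  simp only [Finset.mem_insert, Finset.mem_singleton] at hd'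
  rw [← orderOf_dvd_iff_pow_eq_one] at h2' h3'
  rcases hd' with h | h | h | h
  · exact absurd (by rw [h]; exact one_dvd _) h2'
  · exact absurd h.dvd h2'
  · exact absurd h.dvd h3'
  · exact h

theorem trace_sq_of_mem_center {A : Matrix.SpecialLinearGroup (Fin 2) (ZMod 13)}
    (hA : A ∈ Subgroup.center _) :
    (A : Matrix (Fin 2) (Fin 2) (ZMod 13)).trace ^ 2 = 4 := by
  obtain ⟨r, hr, hrA⟩ := Matrix.SpecialLinearGroup.mem_center_iff.1 hA
  have hr : r ^ 2 = 1 := hr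
  rw [← hrA]
  simp only [Matrix.trace_fin_two, Matrix.scalar_apply, Matrix.diagonal_apply_eq]
  linear_combination 4 * hr

theorem mk_mem_compositeElements_iff (A : Matrix.SpecialLinearGroup (Fin 2) (ZMod 13)) :
    (QuotientGroup.mk A : L213) ∈ compositeElements L213 ↔
      ((A : Matrix (Fin 2) (Fin 2) (ZMod 13)).trace = 4 ∨
        (A : Matrix (Fin 2) (Fin 2) (ZMod 13)).trace = 9) := by
  by_cases hA : A ∈ Subgroup.center (Matrix.SpecialLinearGroup (Fin 2) (ZMod 13))
  · have h1 : (QuotientGroup.mk A : L213) = 1 := (QuotientGroup.eq_one_iff A).2 hA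
    have h2 := trace_sq_of_mem_center hA
    refine iff_of_false (fun h => h.1 h1) ?_
    rintro (h | h) <;> rw [h] at h2 <;> exact absurd h2 (by decide)
  · have h1 : (QuotientGroup.mk A : L213) ≠ 1 := fun h => hA ((QuotientGroup.eq_one_iff A).1 h)
    constructor
    · rintro ⟨-, hp⟩
      by_contra ht
      have key : ∀ p : ℕ, (p + 1).Prime →
          tracePow (A : Matrix (Fin 2) (Fin 2) (ZMod 13)).trace (p + 1) ≠ 0 := by
        intro p hp' h
        have : Fact (p + 1).Prime := ⟨hp'⟩
        exact hp (by
          rwa [orderOf_eq_prime ((Matrix.SpecialLinearGroup.mk_pow_eq_one_iff hA p).2 h) h1])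
      rcases tracePow_prime_cases _ ht with h | h | h | h
      · exact key 1 (by norm_num) h
      · exact key 2 (by norm_num) h
      · exact key 6 (by norm_num) h
      · exact key 12 (by norm_num) h
    · intro ht
      refine ⟨h1, ?_⟩
      rw [orderOf_mk_eq_six hA ht]
      norm_num

/-! ### Counting matrices by trace -/

/-- Given diagonal product `k`, the off-diagonal entries have product `k - 1`: 25 pairs if this is
zero, 12 otherwise. -/
theorem card_mul_eq : ∀ k : ZMod 13,
    (Finset.univ.filter fun q : ZMod 13 × ZMod 13 => k - q.1 * q.2 = 1).card =
      if k = 1 then 25 else 12 := by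
  decide +kernel

/-- Matrices of determinant one as quadruples of entries, the diagonal ones first. -/
def slEquiv : Matrix.SpecialLinearGroup (Fin 2) (ZMod 13) ≃
    {q : (ZMod 13 × ZMod 13) × (ZMod 13 × ZMod 13) // q.1.1 * q.1.2 - q.2.1 * q.2.2 = 1} where
  toFun A := ⟨((A 0 0, A 1 1), (A 0 1, A 1 0)), by
    have := A.det_coe
    rwa [Matrix.det_fin_two] at this⟩
  invFun q := ⟨!![q.1.1.1, q.1.2.1; q.1.2.2, q.1.1.2], by
    rw [Matrix.det_fin_two_of]; exact q.2⟩
  left_inv A := by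
    ext i j
    fin_cases i <;> fin_cases j <;> rfl
  right_inv q := rfl

theorem ncard_trace_mem (S : ZMod 13 → Prop) [DecidablePred S] :
    {A : Matrix.SpecialLinearGroup (Fin 2) (ZMod 13) |
      S (A : Matrix (Fin 2) (Fin 2) (ZMod 13)).trace}.ncard =
    ∑ q : ZMod 13 × ZMod 13, if S (q.1 + q.2) then if q.1 * q.2 = 1 then 25 else 12 else 0 := by
  have h1 : {A : Matrix.SpecialLinearGroup (Fin 2) (ZMod 13) |
      S (A : Matrix (Fin 2) (Fin 2) (ZMod 13)).trace}.ncard =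
      Nat.card {q : (ZMod 13 × ZMod 13) × (ZMod 13 × ZMod 13) //
        q.1.1 * q.1.2 - q.2.1 * q.2.2 = 1 ∧ S (q.1.1 + q.1.2)} := by
    change _ = {q : (ZMod 13 × ZMod 13) × (ZMod 13 × ZMod 13) |
        q.1.1 * q.1.2 - q.2.1 * q.2.2 = 1 ∧ S (q.1.1 + q.1.2)}.ncard
    refine Set.ncard_congr (fun A _ => (slEquiv A).1) ?_ ?_ ?_
    · intro A hA
      have hA : S (A : Matrix (Fin 2) (Fin 2) (ZMod 13)).trace := hA
      rw [Matrix.trace_fin_two] at hA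
      exact ⟨(slEquiv A).2, hA⟩
    · intro A B _ _ h
      exact slEquiv.injective (Subtype.ext h)
    · intro q hq
      have hq : q.1.1 * q.1.2 - q.2.1 * q.2.2 = 1 ∧ S (q.1.1 + q.1.2) := hq
      refine ⟨slEquiv.symm ⟨q, hq.1⟩, ?_, congrArg Subtype.val (slEquiv.apply_symm_apply _)⟩
      change S (Matrix.trace _)
      rw [Matrix.trace_fin_two]
      exact hq.2
  rw [h1, Nat.card_eq_fintype_card, Fintype.card_subtype, Finset.card_filter, Fintype.sum_prod_type]
  refine Finset.sum_congr rfl fun q _ => ?_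
  by_cases hS : S (q.1 + q.2)
  · simp only [hS, and_true, if_true]
    rw [← Finset.card_filter, card_mul_eq]
  · simp [hS]

theorem card_SL_two_thirteen :
    Nat.card (Matrix.SpecialLinearGroup (Fin 2) (ZMod 13)) = 2184 := by
  have h := ncard_trace_mem fun _ => True
  rw [Set.ofPred_true, Set.ncard_univ] at h
  rw [h]
  decide +kernel

theorem ncard_trace_four_or_nine : {A : Matrix.SpecialLinearGroup (Fin 2) (ZMod 13) |
    (A : Matrix (Fin 2) (Fin 2) (ZMod 13)).trace = 4 ∨
      (A : Matrix (Fin 2) (Fin 2) (ZMod 13)).trace = 9}.ncard = 364 := by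
  rw [ncard_trace_mem fun t => t = 4 ∨ t = 9]
  decide +kernel

theorem card_center_SL_two_thirteen :
    Nat.card (Subgroup.center (Matrix.SpecialLinearGroup (Fin 2) (ZMod 13))) = 2 := by
  rw [Nat.card_congr (Matrix.SpecialLinearGroup.center_equiv_rootsOfUnity' 0).toEquiv]
  exact (IsPrimitiveRoot.neg_one (R := ZMod 13) 13 (by norm_num)).card_rootsOfUnity

theorem card_L213 : Nat.card L213 = 1092 := by
  have h := Subgroup.card_eq_card_quotient_mul_card_subgroup
    (Subgroup.center (Matrix.SpecialLinearGroup (Fin 2) (ZMod 13)))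
  rw [card_SL_two_thirteen, card_center_SL_two_thirteen] at h
  change 2184 = Nat.card L213 * 2 at h
  omega

theorem ncard_compositeElements_L213 : (compositeElements L213).ncard = 182 := by
  have h := QuotientGroup.card_preimage_mk
    (Subgroup.center (Matrix.SpecialLinearGroup (Fin 2) (ZMod 13))) (compositeElements L213)
  have hpre : QuotientGroup.mk ⁻¹' (compositeElements L213) =
      {A : Matrix.SpecialLinearGroup (Fin 2) (ZMod 13) |
        (A : Matrix (Fin 2) (Fin 2) (ZMod 13)).trace = 4 ∨
          (A : Matrix (Fin 2) (Fin 2) (ZMod 13)).trace = 9} :=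
    Set.ext mk_mem_compositeElements_iff
  rw [hpre, Nat.card_coe_set_eq, Nat.card_coe_set_eq, ncard_trace_four_or_nine,
    card_center_SL_two_thirteen] at h
  omega

theorem OmegaRho_L213 : OmegaRho L213 = 1273 := by
  rw [OmegaRho_eq_of_compositeElements, card_L213, ncard_compositeElements_L213]
  intro x hx
  obtain ⟨A, rfl⟩ := QuotientGroup.mk_surjective x
  have ht := (mk_mem_compositeElements_iff A).1 hx
  have hA : A ∉ Subgroup.center _ := fun h => hx.1 ((QuotientGroup.eq_one_iff A).2 h)
  rw [orderOf_mk_eq_six hA ht, show 6 = 2 * 3 by norm_num,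
    ArithmeticFunction.cardFactors_mul (by norm_num) (by norm_num),
    ArithmeticFunction.cardFactors_apply_prime (by norm_num),
    ArithmeticFunction.cardFactors_apply_prime (by norm_num)]

/-! ### Characterization of `L213` -/

theorem nonempty_mulEquiv_L213_of_OmegaRho_le (G : Type*) [Group G] [Finite G]
    (hG : Nat.card G = 1092) (h : OmegaRho G ≤ 1273) : Nonempty (G ≃* L213) := by
  have hc : (compositeElements G).ncard ≤ 182 := by
    have := card_add_ncard_compositeElements_le G
    rw [hG] at this
    omega
  obtain ⟨φ, hφ, hr⟩ := exists_hom_range_eq_squareMoebius hG hc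
  -- `L213` meets the bound 182 with equality, so the same rigidity result applies to it.
  obtain ⟨ψ, hψ, hs⟩ := exists_hom_range_eq_squareMoebius card_L213
    ncard_compositeElements_L213.le
  have heq : φ.range = ψ.range := SetLike.coe_injective (hr.trans hs.symm)
  exact ⟨((MonoidHom.ofInjective hφ).trans (MulEquiv.subgroupCongr heq)).trans
    (MonoidHom.ofInjective hψ).symm⟩

theorem mainTheorem7 (G : Type*) [Group G] [Finite G] (hG : Nat.card G = 1092) :
    OmegaRho L213 ≤ OmegaRho G ∧ OmegaRho L213 = 1273 ∧
      (OmegaRho G = 1273 ↔ Nonempty (G ≃* L213)) := by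
  refine ⟨?_, OmegaRho_L213, fun h => nonempty_mulEquiv_L213_of_OmegaRho_le G hG h.le,
    fun ⟨e⟩ => (OmegaRho_congr e).trans OmegaRho_L213⟩
  rcases le_total (OmegaRho L213) (OmegaRho G) with h | h
  · exact h
  · obtain ⟨e⟩ := nonempty_mulEquiv_L213_of_OmegaRho_le G hG (h.trans OmegaRho_L213.le)
    exact (OmegaRho_congr e).ge
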